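/- A standard triangular array is a family $\{\xi_{n,k}\}_{1\le k\le n,\ n\ge 1}$ of square-integrable real random variables on a probability space such that, for each $n$, the variables $\xi_{n,1},\dots,\xi_{n,n}$ are independent, $\mathbb{E}[\xi_{n,k}]=0$ for all $k$, and $\sum_{k=1}^n\mathbb{E}[\xi_{n,k}^2]=1$. It is Feller-negligible if $\max_{1\le k\le n}\mathbb{E}[\xi_{n,k}^2]\to 0$ as $n\to\infty$. Its Lindeberg index is $$\mathrm{Lin}(\{\xi_{n,k}\})=\sup_{\epsilon>0}\limsup_{n\to\infty}\sum_{k=1}^n\mathbb{E}\left[\xi_{n,k}^2\,\mathbf{1}_{\{|\xi_{n,k}|\ge\epsilon\}}\right].$$ For real random variables $\eta,\eta'$ let $K(\eta,\eta')=\sup_{x\in\mathbb{R}}\left|\mathbb{P}[\eta\le x]-\mathbb{P}[\eta'\le x]\right|$ be the Kolmogorov distance, and let $\xi$ be a standard normal random variable. Theorem. There do not exist constants $C>0$ and $p>0$ such that $$\limsup_{n\to\infty}K\left(\xi,\sum_{k=1}^n\xi_{n,k}\right)\le C\left[\mathrm{Lin}(\{\xi_{n,k}\})\right]^{1+p}$$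 holds for every Feller-negligible standard triangular array $\{\xi_{n,k}\}$. -/

import Mathlib

open MeasureTheory ProbabilityTheory Filter Topology

noncomputable section

namespace LindebergFeller

/-- Standard triangular array. Row `n` consists of the `n` variables `ξ n k`, `k : Fin n`
(the index `k : Fin n` stands for the position `k + 1`); the rows that matter are those with
`1 ≤ n`, the row `n = 0` being empty. Nothing is assumed about the joint law of different rows. -/
structure IsSTA {Ω : Type*} [MeasurableSpace Ω] (μ : Measure Ω)
    (ξ : (n : ℕ) → Fin n → Ω → ℝ) : Prop where
  measurable : ∀ n k, Measurable (ξ n k)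
  square_integrable : ∀ n k, MemLp (ξ n k) 2 μ
  indep : ∀ n, iIndepFun (ξ n) μ
  mean_zero : ∀ n k, ∫ ω, ξ n k ω ∂μ = 0
  sum_variance : ∀ n, 1 ≤ n → ∑ k : Fin n, ∫ ω, (ξ n k ω) ^ 2 ∂μ = 1

/-- Feller's negligibility condition: `max_{1 ≤ k ≤ n} E[ξ_{n,k}²] → 0`. -/
def FellerNegligible {Ω : Type*} [MeasurableSpace Ω] (μ : Measure Ω)
    (ξ : (n : ℕ) → Fin n → Ω → ℝ) : Prop :=
  Tendsto (fun n : ℕ => ⨆ k : Fin n, ∫ ω, (ξ n k ω) ^ 2 ∂μ) atTop (𝓝 0)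

/-- Kolmogorov distance `sup_x |P[X ≤ x] - P[Y ≤ x]|` of two random variables, which may
live on different probability spaces. -/
def kolmogorovDist {Ω Ω' : Type*} [MeasurableSpace Ω] [MeasurableSpace Ω']
    (μ : Measure Ω) (ν : Measure Ω') (X : Ω → ℝ) (Y : Ω' → ℝ) : ℝ :=
  ⨆ x : ℝ, |μ.real {ω | X ω ≤ x} - ν.real {ω | Y ω ≤ x}|

/-- Lindeberg index `sup_{ε > 0} limsup_n ∑_k E[ξ_{n,k}² ; |ξ_{n,k}| ≥ ε]`. For a standard
triangular array all the sums with `1 ≤ n` lie in `[0, 1]`, so it is a real number in `[0, 1]`. -/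
def lindebergIndex {Ω : Type*} [MeasurableSpace Ω] (μ : Measure Ω)
    (ξ : (n : ℕ) → Fin n → Ω → ℝ) : ℝ :=
  ⨆ ε : Set.Ioi (0 : ℝ),
    limsup (fun n : ℕ => ∑ k : Fin n, ∫ ω in {ω | (ε : ℝ) ≤ |ξ n k ω|}, (ξ n k ω) ^ 2 ∂μ) atTop

end LindebergFeller

end

namespace LindebergFeller

/-! For each `a ∈ (0, 1)` an array with i.i.d. rows mixes rare jumps `±1`, of total weight `a / n`,
with jumps `±smallJump a n` that carry the remaining variance `1 - a`. Each entry has variance `1 /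
n`, and only the rare jumps survive truncation, so the Lindeberg index is `a`. The row sums converge
to a Gaussian of variance `1 - a` plus an independent compound Poisson part, with characteristic
function `exp (limitExponent a t)`. The test function `e^{-x²/2}` detects the gap to the normal law:
its integrals differ by at most twice the Kolmogorov distance
(`abs_integral_exp_neg_sq_div_two_sub_le`), and by Fourier duality they are Gaussian averages of
characteristic functions (`ofReal_integral_exp_neg_sq_div_two`). The limiting gap is at least `a *
c`, with `c > 0` the Gaussian mean of `cosExcess`. Hence `a * c / 2 ≤ C * a ^ (1 + p)` for all such
`a`, which is impossible as `a → 0`. -/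

/-! ### The Gaussian test function and the Kolmogorov distance. -/

theorem integrable_exp_neg_sq_div_two (P : Measure ℝ) [IsFiniteMeasure P] :
    Integrable (fun x : ℝ => Real.exp (-x ^ 2 / 2)) P := by
  refine Integrable.of_bound (by fun_prop) 1 (ae_of_all _ fun x => ?_)
  rw [Real.norm_eq_abs, abs_of_pos (Real.exp_pos _), Real.exp_le_one_iff]
  nlinarith [sq_nonneg x]

/-- The integrand on the left is the characteristic function of the standard normal law, so Fubini
swaps the roles of the two measures. -/
theorem ofReal_integral_exp_neg_sq_div_two (P : Measure ℝ) [IsProbabilityMeasure P] :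
    ((∫ x, Real.exp (-x ^ 2 / 2) ∂P : ℝ) : ℂ) = ∫ t, charFun P t ∂(gaussianReal 0 1) := by
  simp_rw [charFun_apply_real]
  rw [integral_integral_swap, ← integral_complex_ofReal]
  · refine integral_congr_ae (ae_of_all _ fun x => ?_)
    have h := charFun_gaussianReal (μ := 0) (v := 1) x
    rw [charFun_apply_real] at h
    calc ((Real.exp (-x ^ 2 / 2) : ℝ) : ℂ)
        = Complex.exp (x * (0 : ℝ) * Complex.I - (1 : NNReal) * x ^ 2 / 2) := by
          push_cast; congr 1; simp; ring
      _ = _ := by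
          rw [← h]
          refine integral_congr_ae (ae_of_all _ fun t => ?_)
          dsimp only
          congr 1; ring
  · refine Integrable.of_bound (by fun_prop) 1 (ae_of_all _ fun x => ?_)
    have : Function.uncurry (fun (t x : ℝ) => Complex.exp (t * x * Complex.I)) x
      = Complex.exp ((x.1 * x.2 : ℝ) * Complex.I) := by
      simp [Function.uncurry]
    rw [this, Complex.norm_exp_ofReal_mul_I]

theorem abs_measureReal_Iio_sub_le {P Q : Measure ℝ} [IsProbabilityMeasure P]
    [IsProbabilityMeasure Q] {K : ℝ}
    (h : ∀ x, |P.real (Set.Iic x) - Q.real (Set.Iic x)| ≤ K) (x : ℝ) :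
    |P.real (Set.Iio x) - Q.real (Set.Iio x)| ≤ K := by
  obtain ⟨u, hu, hux, hlim⟩ := exists_seq_strictMono_tendsto x
  have hU : ⋃ n, Set.Iic (u n) = Set.Iio x := by
    ext y
    simp only [Set.mem_iUnion, Set.mem_Iic, Set.mem_Iio]
    refine ⟨fun ⟨n, hn⟩ => hn.trans_lt (hux n), fun hy => ?_⟩
    obtain ⟨n, hn⟩ := (hlim.eventually (lt_mem_nhds hy)).exists
    exact ⟨n, hn.le⟩
  have hm : Monotone fun n => Set.Iic (u n) := fun i j hij => Set.Iic_subset_Iic.2 (hu.monotone hij)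
  have key (ρ : Measure ℝ) [IsProbabilityMeasure ρ] :
      Tendsto (fun n => ρ.real (Set.Iic (u n))) atTop (𝓝 (ρ.real (Set.Iio x))) := by
    have := tendsto_measure_iUnion_atTop (μ := ρ) hm
    rw [hU] at this
    exact (ENNReal.tendsto_toReal (measure_ne_top _ _)).comp this
  exact le_of_tendsto ((key P).sub (key Q)).abs (Eventually.of_forall fun n => h _)

/-- Layer cake: for levels `t ∈ (0, 1]` the superlevel sets are closed symmetric intervals. The mass
of each is a difference of two half-line masses, and each of these costs at most `K`; the left
endpoint needs the open half-line version. -/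
theorem abs_integral_exp_neg_sq_div_two_sub_le {P Q : Measure ℝ} [IsProbabilityMeasure P]
    [IsProbabilityMeasure Q] {K : ℝ}
    (h : ∀ x, |P.real (Set.Iic x) - Q.real (Set.Iic x)| ≤ K) :
    |∫ x, Real.exp (-x ^ 2 / 2) ∂P - ∫ x, Real.exp (-x ^ 2 / 2) ∂Q| ≤ 2 * K := by
  have rep (ρ : Measure ℝ) [IsProbabilityMeasure ρ] :
      ∫ x, Real.exp (-x ^ 2 / 2) ∂ρ
        = ∫ t in Set.Ioc 0 1, ρ.real {x | t ≤ Real.exp (-x ^ 2 / 2)} :=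
    (integrable_exp_neg_sq_div_two ρ).integral_eq_integral_Ioc_meas_le
      (ae_of_all _ fun x => (Real.exp_pos _).le)
      (ae_of_all _ fun x => by
        rw [Real.exp_le_one_iff]; nlinarith [sq_nonneg x])
  have int (ρ : Measure ℝ) [IsProbabilityMeasure ρ] :
      IntegrableOn (fun t => ρ.real {x | t ≤ Real.exp (-x ^ 2 / 2)}) (Set.Ioc (0 : ℝ) 1) := by
    have hanti : Antitone (fun t => ρ.real {x | t ≤ Real.exp (-x ^ 2 / 2)}) := fun s t hst =>
      measureReal_mono fun x hx => hst.trans hx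
    refine Integrable.of_bound hanti.measurable.aestronglyMeasurable 1 (ae_of_all _ fun t => ?_)
    rw [Real.norm_eq_abs, abs_of_nonneg measureReal_nonneg]
    exact measureReal_le_one
  have level (t : ℝ) (ht : t ∈ Set.Ioc (0 : ℝ) 1) :
      {x : ℝ | t ≤ Real.exp (-x ^ 2 / 2)}
        = Set.Iic (√(-2 * Real.log t)) \ Set.Iio (-√(-2 * Real.log t)) := by
    ext x
    have h1 : t ≤ Real.exp (-x ^ 2 / 2) ↔ x ^ 2 ≤ -2 * Real.log t := by
      rw [← Real.log_le_iff_le_exp ht.1]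
      constructor <;> intro h <;> linarith
    have h2 : 0 ≤ -2 * Real.log t := by linarith [Real.log_nonpos ht.1.le ht.2]
    rw [Set.mem_ofPred_eq, h1, ← Real.sqrt_le_sqrt_iff h2, Real.sqrt_sq_eq_abs, abs_le]
    simp [and_comm]
  have val (ρ : Measure ℝ) [IsProbabilityMeasure ρ] (t : ℝ) (ht : t ∈ Set.Ioc (0 : ℝ) 1) :
      ρ.real {x : ℝ | t ≤ Real.exp (-x ^ 2 / 2)}
        = ρ.real (Set.Iic (√(-2 * Real.log t))) - ρ.real (Set.Iio (-√(-2 * Real.log t))) := by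
    rw [level t ht, measureReal_sdiff _ measurableSet_Iio]
    intro x hx
    have := Real.sqrt_nonneg (-2 * Real.log t)
    simp only [Set.mem_Iio, Set.mem_Iic] at *
    linarith
  rw [rep P, rep Q, ← integral_sub (int P) (int Q), ← Real.norm_eq_abs]
  refine (norm_setIntegral_le_of_norm_le_const (C := 2 * K) (by simp) fun t ht => ?_).trans_eq
    (by simp)
  rw [Real.norm_eq_abs, val P t ht, val Q t ht]
  have h1 := h (√(-2 * Real.log t))
  have h2 := abs_measureReal_Iio_sub_le h (-√(-2 * Real.log t))
  rw [abs_le] at *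
  constructor <;> linarith

theorem abs_measureReal_sub_le_kolmogorovDist {Ω Ω' : Type*} [MeasurableSpace Ω]
    [MeasurableSpace Ω'] (μ : Measure Ω) (ν : Measure Ω') [IsProbabilityMeasure μ]
    [IsProbabilityMeasure ν] (X : Ω → ℝ) (Y : Ω' → ℝ) (x : ℝ) :
    |μ.real {ω | X ω ≤ x} - ν.real {ω | Y ω ≤ x}| ≤ kolmogorovDist μ ν X Y := by
  refine le_ciSup (f := fun x : ℝ => |μ.real {ω | X ω ≤ x} - ν.real {ω | Y ω ≤ x}|)
    ⟨1, ?_⟩ x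
  rintro _ ⟨y, rfl⟩
  exact abs_sub_le_of_nonneg_of_le measureReal_nonneg measureReal_le_one measureReal_nonneg
    measureReal_le_one

theorem kolmogorovDist_le_one {Ω Ω' : Type*} [MeasurableSpace Ω]
    [MeasurableSpace Ω'] (μ : Measure Ω) (ν : Measure Ω') [IsProbabilityMeasure μ]
    [IsProbabilityMeasure ν] (X : Ω → ℝ) (Y : Ω' → ℝ) : kolmogorovDist μ ν X Y ≤ 1 :=
  ciSup_le fun _ => abs_sub_le_of_nonneg_of_le measureReal_nonneg measureReal_le_one
    measureReal_nonneg measureReal_le_one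

theorem abs_integral_exp_neg_sq_div_two_sub_le_kolmogorovDist {Ω Ω' : Type*} [MeasurableSpace Ω]
    [MeasurableSpace Ω'] {μ : Measure Ω} {ν : Measure Ω'} [IsProbabilityMeasure μ]
    [IsProbabilityMeasure ν] {X : Ω → ℝ} {Y : Ω' → ℝ} (hX : AEMeasurable X μ)
    (hY : AEMeasurable Y ν) :
    |∫ x, Real.exp (-x ^ 2 / 2) ∂(μ.map X) - ∫ x, Real.exp (-x ^ 2 / 2) ∂(ν.map Y)|
      ≤ 2 * kolmogorovDist μ ν X Y := by
  have := Measure.isProbabilityMeasure_map hX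
  have := Measure.isProbabilityMeasure_map hY
  refine abs_integral_exp_neg_sq_div_two_sub_le fun x => ?_
  rw [map_measureReal_apply_of_aemeasurable hX measurableSet_Iic,
    map_measureReal_apply_of_aemeasurable hY measurableSet_Iic]
  exact abs_measureReal_sub_le_kolmogorovDist μ ν X Y x

/-! ### Excess of the limiting characteristic function over the Gaussian one. -/

/-- The nonnegative function `t ↦ e^{-t²/2} (t²/2 - 1 + cos t)`. -/
noncomputable def cosExcess (t : ℝ) : ℝ := Real.exp (-t ^ 2 / 2) * (t ^ 2 / 2 - 1 + Real.cos t)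

theorem cosExcess_nonneg (t : ℝ) : 0 ≤ cosExcess t :=
  mul_nonneg (Real.exp_pos _).le (by linarith [Real.one_sub_sq_div_two_le_cos (x := t)])

theorem continuous_cosExcess : Continuous cosExcess := by unfold cosExcess; fun_prop

theorem cosExcess_le_one (t : ℝ) : cosExcess t ≤ 1 := by
  have h1 : t ^ 2 / 2 - 1 + Real.cos t ≤ Real.exp (t ^ 2 / 2) := by
    linarith [Real.cos_le_one t, Real.add_one_le_exp (t ^ 2 / 2)]
  calc cosExcess t ≤ Real.exp (-t ^ 2 / 2) * Real.exp (t ^ 2 / 2) :=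
        mul_le_mul_of_nonneg_left h1 (Real.exp_pos _).le
    _ = 1 := by rw [← Real.exp_add]; simp [neg_div]

theorem integrable_cosExcess (P : Measure ℝ) [IsFiniteMeasure P] : Integrable cosExcess P :=
  Integrable.of_bound continuous_cosExcess.aestronglyMeasurable 1 (ae_of_all _ fun t => by
    rw [Real.norm_eq_abs, abs_of_nonneg (cosExcess_nonneg t)]; exact cosExcess_le_one t)

theorem integral_cosExcess_pos : 0 < ∫ t, cosExcess t ∂(gaussianReal 0 1) := by
  refine lt_of_le_of_ne (integral_nonneg cosExcess_nonneg) fun h => ?_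
  have h0 := (integral_eq_zero_iff_of_nonneg cosExcess_nonneg (integrable_cosExcess _)).1 h.symm
  have h1 : cosExcess =ᵐ[volume] 0 :=
    (gaussianReal_absolutelyContinuous' 0 one_ne_zero).ae_le h0
  -- Continuity turns a.e. vanishing into vanishing everywhere, but at `π` the second factor is `π²
  -- / 2 - 2 > 0`.
  have h2 : cosExcess Real.pi = 0 := congrFun ((continuous_cosExcess.ae_eq_iff_eq volume continuous_const).1 h1) Real.pi
  have h3 := Real.pi_gt_three
  simp only [cosExcess, Real.cos_pi, mul_eq_zero, Real.exp_ne_zero, false_or] at h2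
  nlinarith

/-- The exponent of the limiting characteristic function. -/
noncomputable def limitExponent (a t : ℝ) : ℝ := -(1 - a) * t ^ 2 / 2 - a * (1 - Real.cos t)

/-- Factor out `e^{-t²/2}` and apply `1 + u ≤ e^u`; this makes the gap at least linear in `a`. -/
theorem add_mul_cosExcess_le (a t : ℝ) :
    Real.exp (-t ^ 2 / 2) + a * cosExcess t ≤ Real.exp (limitExponent a t) := by
  have : limitExponent a t = -t ^ 2 / 2 + a * (t ^ 2 / 2 - 1 + Real.cos t) := by
    unfold limitExponent; ring
  rw [this, Real.exp_add, cosExcess]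
  nlinarith [Real.add_one_le_exp (a * (t ^ 2 / 2 - 1 + Real.cos t)), Real.exp_pos (-t ^ 2 / 2)]

theorem integrable_exp_limitExponent {a : ℝ} (h0 : 0 ≤ a) (h1 : a ≤ 1) (P : Measure ℝ)
    [IsFiniteMeasure P] : Integrable (fun t => Real.exp (limitExponent a t)) P := by
  refine Integrable.of_bound ?_ 1 (ae_of_all _ fun t => ?_)
  · unfold limitExponent; fun_prop
  · rw [Real.norm_eq_abs, abs_of_pos (Real.exp_pos _), Real.exp_le_one_iff, limitExponent]
    nlinarith [mul_nonneg h0 (sub_nonneg.2 (Real.cos_le_one t)),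
      mul_nonneg (sub_nonneg.2 h1) (sq_nonneg t)]

/-! ### Convergence of the characteristic functions of the row sums. -/

/-- Size of the small jumps in the `n`-th row. -/
noncomputable def smallJump (a : ℝ) (n : ℕ) : ℝ := √((1 - a) / (n - a))

theorem tendsto_smallJump (a : ℝ) : Tendsto (smallJump a) atTop (𝓝 0) := by
  have : Tendsto (fun n : ℕ => (1 - a) / ((n : ℝ) - a)) atTop (𝓝 0) :=
    tendsto_const_nhds.div_atTop (tendsto_atTop_add_const_right _ _ tendsto_natCast_atTop_atTop)
  unfold smallJump
  simpa using this.sqrt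

/-- This is the variance normalization: the `n` entries contribute `a` through the unit jumps and
`(n - a) * smallJump a n ^ 2` through the small ones. -/
theorem sub_mul_smallJump_sq {a : ℝ} (h1 : a < 1) {n : ℕ} (hn : 1 ≤ n) :
    ((n : ℝ) - a) * smallJump a n ^ 2 = 1 - a := by
  have h : (1 : ℝ) ≤ n := by exact_mod_cast hn
  have hpos : 0 < (n : ℝ) - a := by linarith
  rw [smallJump, Real.sq_sqrt (div_nonneg (by linarith) hpos.le), mul_div_cancel₀ _ hpos.ne']

/-- Characteristic function of the common law in the `n`-th row. -/
noncomputable def rowCharFun (a : ℝ) (n : ℕ) (t : ℝ) : ℝ :=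
  a / n * Real.cos t + (1 - a / n) * Real.cos (smallJump a n * t)

theorem tendsto_rowCharFun_pow {a : ℝ} (h1 : a < 1) (t : ℝ) :
    Tendsto (fun n => rowCharFun a n t ^ n) atTop (𝓝 (Real.exp (limitExponent a t))) := by
  have hb := tendsto_smallJump a
  suffices h : Tendsto (fun n : ℕ => (n : ℝ) * (rowCharFun a n t - 1)) atTop
      (𝓝 (limitExponent a t)) by
    simpa using Real.tendsto_one_add_pow_exp_of_tendsto h
  have hbt : Tendsto (fun n => |smallJump a n * t|) atTop (𝓝 0) := by
    simpa using (hb.mul_const t).abs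
  have hsmall : ∀ᶠ n in atTop, |smallJump a n * t| ≤ 1 := hbt.eventually_le_const zero_lt_one
  rw [tendsto_iff_norm_sub_tendsto_zero]
  -- The unit jumps match the limit exactly. The small ones leave the Taylor error `5 / 96 * |x| ^
  -- 4` of `Real.cos_bound`, times `n - a`, and one factor `smallJump a n ^ 2` absorbs `n - a`.
  refine squeeze_zero' (g := fun n => (1 - a) * smallJump a n ^ 2 * t ^ 4 * (5 / 96))
    (Eventually.of_forall fun n => norm_nonneg _) ?_ ?_
  · filter_upwards [hsmall, eventually_ge_atTop 1] with n hn hn1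
    have hcos := Real.cos_bound hn
    have hsq := sub_mul_smallJump_sq h1 hn1
    have h : (1 : ℝ) ≤ n := by exact_mod_cast hn1
    have hpos : 0 < (n : ℝ) - a := by linarith
    set b := smallJump a n
    have e : (n : ℝ) * (rowCharFun a n t - 1) - limitExponent a t
        = (n - a) * (Real.cos (b * t) - (1 - (b * t) ^ 2 / 2)) := by
      have : (n : ℝ) * (rowCharFun a n t - 1)
        = (n - a) * (Real.cos (b * t) - 1) - a * (1 - Real.cos t) := by
        change (n : ℝ) * (a / n * Real.cos t + (1 - a / n) * Real.cos (b * t) - 1) = _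
        field_simp; ring
      rw [this, limitExponent, ← hsq]; ring
    rw [e, norm_mul, Real.norm_eq_abs, Real.norm_eq_abs, abs_of_pos hpos]
    refine (mul_le_mul_of_nonneg_left hcos hpos.le).trans_eq ?_
    rw [← hsq, Even.pow_abs (by decide)]; ring
  · simpa using (((hb.pow 2).const_mul (1 - a)).mul_const (t ^ 4)).mul_const (5 / 96)

theorem div_natCast_mem_Icc {a : ℝ} (h0 : 0 ≤ a) (h1 : a ≤ 1) (n : ℕ) :
    0 ≤ a / n ∧ a / n ≤ 1 := by
  refine ⟨by positivity, ?_⟩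
  rcases Nat.eq_zero_or_pos n with rfl | hn
  -- In the empty row, `a / 0 = 0`.
  · simp
  · exact div_le_one_of_le₀ (h1.trans (by exact_mod_cast hn)) (by positivity)

theorem abs_rowCharFun_le_one {a : ℝ} (h0 : 0 ≤ a) (h1 : a ≤ 1) (n : ℕ) (t : ℝ) :
    |rowCharFun a n t| ≤ 1 := by
  obtain ⟨hw0, hw1⟩ := div_natCast_mem_Icc h0 h1 n
  have e1 := Real.neg_one_le_cos t
  have e2 := Real.cos_le_one t
  have e3 := Real.neg_one_le_cos (smallJump a n * t)
  have e4 := Real.cos_le_one (smallJump a n * t)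
  rw [abs_le, rowCharFun]
  constructor <;> nlinarith

theorem tendsto_integral_rowCharFun_pow {a : ℝ} (h0 : 0 ≤ a) (h1 : a < 1) (P : Measure ℝ)
    [IsFiniteMeasure P] :
    Tendsto (fun n => ∫ t, rowCharFun a n t ^ n ∂P) atTop
      (𝓝 (∫ t, Real.exp (limitExponent a t) ∂P)) := by
  refine tendsto_integral_of_dominated_convergence (fun _ => 1) (fun n => ?_)
    (integrable_const _) (fun n => ae_of_all _ fun t => ?_)
    (ae_of_all _ fun t => tendsto_rowCharFun_pow h1 t)
  · unfold rowCharFun; fun_prop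
  · rw [norm_pow]
    exact pow_le_one₀ (norm_nonneg _) (abs_rowCharFun_le_one h0 h1.le n t)

/-! ### The law of an entry and its moments. -/

/-- The common law in the `n`-th row: `±1` with total weight `a / n` and `±smallJump a n` with the
remaining weight. -/
noncomputable def rowLaw (a : ℝ) (n : ℕ) : Measure ℝ :=
  ENNReal.ofReal (a / n / 2) • (Measure.dirac 1 + Measure.dirac (-1)) +
    ENNReal.ofReal ((1 - a / n) / 2) •
      (Measure.dirac (smallJump a n) + Measure.dirac (-smallJump a n))

theorem isProbabilityMeasure_rowLaw {a : ℝ} (h0 : 0 ≤ a) (h1 : a ≤ 1) (n : ℕ) :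
    IsProbabilityMeasure (rowLaw a n) := by
  obtain ⟨hw0, hw1⟩ := div_natCast_mem_Icc h0 h1 n
  constructor
  simp only [rowLaw, Measure.add_apply, Measure.smul_apply, measure_univ, smul_eq_mul]
  rw [one_add_one_eq_two, ← add_mul, ← ENNReal.ofReal_add (by linarith) (by linarith),
    ← ENNReal.ofReal_ofNat 2, ← ENNReal.ofReal_mul (by linarith)]
  ring_nf
  simp

theorem integrable_rowLaw {E : Type*} [NormedAddCommGroup E] (a : ℝ) (n : ℕ) (f : ℝ → E) :
    Integrable f (rowLaw a n) := by
  have h (x : ℝ) : Integrable f (Measure.dirac x) := integrable_dirac (by simp)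
  exact (((h _).add_measure (h _)).smul_measure ENNReal.ofReal_ne_top).add_measure
    (((h _).add_measure (h _)).smul_measure ENNReal.ofReal_ne_top)

theorem integral_rowLaw {E : Type*} [NormedAddCommGroup E] [NormedSpace ℝ E] [CompleteSpace E]
    {a : ℝ} (h0 : 0 ≤ a) (h1 : a ≤ 1) (n : ℕ) (f : ℝ → E) :
    ∫ x, f x ∂(rowLaw a n) = (a / n / 2) • (f 1 + f (-1)) +
      ((1 - a / n) / 2) • (f (smallJump a n) + f (-smallJump a n)) := by
  obtain ⟨hw0, hw1⟩ := div_natCast_mem_Icc h0 h1 n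
  have h (x : ℝ) : Integrable f (Measure.dirac x) := integrable_dirac (by simp)
  rw [rowLaw, integral_add_measure
      (((h _).add_measure (h _)).smul_measure ENNReal.ofReal_ne_top)
      (((h _).add_measure (h _)).smul_measure ENNReal.ofReal_ne_top),
    integral_smul_measure, integral_smul_measure, integral_add_measure (h _) (h _),
    integral_add_measure (h _) (h _), ENNReal.toReal_ofReal (by linarith),
    ENNReal.toReal_ofReal (by linarith)]
  simp only [integral_dirac]

theorem charFun_rowLaw {a : ℝ} (h0 : 0 ≤ a) (h1 : a ≤ 1) (n : ℕ) (t : ℝ) :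
    charFun (rowLaw a n) t = rowCharFun a n t := by
  have key (x : ℝ) : Complex.exp (t * x * Complex.I) + Complex.exp (t * (-x : ℝ) * Complex.I)
      = 2 * Real.cos (x * t) := by
    push_cast
    rw [Complex.two_cos]
    ring_nf
  rw [charFun_apply_real, integral_rowLaw h0 h1, key, key, rowCharFun]
  simp only [Complex.real_smul]
  push_cast
  ring_nf

/-- `n` times the second moment of `rowLaw a n` restricted to `{ε ≤ |x|}`. -/
theorem integral_indicator_sq_rowLaw {a : ℝ} (h0 : 0 ≤ a) (h1 : a < 1) {n : ℕ} (hn : 1 ≤ n)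
    (ε : ℝ) :
    n * ∫ x, {x : ℝ | ε ≤ |x|}.indicator (fun x => x ^ 2) x ∂(rowLaw a n)
      = (if ε ≤ 1 then a else 0) + (if ε ≤ smallJump a n then 1 - a else 0) := by
  have hb : 0 ≤ smallJump a n := Real.sqrt_nonneg _
  have hn0 : (n : ℝ) ≠ 0 := by positivity
  rw [integral_rowLaw h0 h1.le, ← sub_mul_smallJump_sq h1 hn]
  simp only [Set.indicator_apply, Set.mem_ofPred_eq, abs_neg, abs_one, abs_of_nonneg hb,
    smul_eq_mul]
  split_ifs <;> field_simp <;> ring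

theorem integral_sq_rowLaw {a : ℝ} (h0 : 0 ≤ a) (h1 : a < 1) {n : ℕ} (hn : 1 ≤ n) :
    ∫ x, x ^ 2 ∂(rowLaw a n) = 1 / n := by
  have hn0 : (n : ℝ) ≠ 0 := by positivity
  -- Truncation at level `0` removes nothing, so both contributions `a` and `1 - a` are present.
  have h := integral_indicator_sq_rowLaw h0 h1 hn 0
  have hb : 0 ≤ smallJump a n := Real.sqrt_nonneg _
  simp only [abs_nonneg, Set.ofPred_true, Set.indicator_univ, zero_le_one, if_true, hb] at h
  rw [eq_div_iff hn0, mul_comm, h]; ring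

theorem integral_id_rowLaw {a : ℝ} (h0 : 0 ≤ a) (h1 : a ≤ 1) (n : ℕ) :
    ∫ x, x ∂(rowLaw a n) = 0 := by
  rw [integral_rowLaw h0 h1]; simp

/-! ### The array on a product space, and its Lindeberg index. -/

/-- The probability space carrying all the rows: one independent coordinate per entry. -/
noncomputable def arrayMeasure (a : ℝ) : Measure ((Σ n : ℕ, Fin n) → ℝ) :=
  Measure.infinitePi fun i => rowLaw a i.1

/-- The entries of the array. -/
def arrayEntry (n : ℕ) (k : Fin n) (ω : (Σ n : ℕ, Fin n) → ℝ) : ℝ := ω ⟨n, k⟩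

theorem measurable_arrayEntry (n : ℕ) (k : Fin n) : Measurable (arrayEntry n k) :=
  measurable_pi_apply _

section Array

variable {a : ℝ}

theorem isProbabilityMeasure_arrayMeasure (h0 : 0 ≤ a) (h1 : a ≤ 1) :
    IsProbabilityMeasure (arrayMeasure a) := by
  have := isProbabilityMeasure_rowLaw h0 h1
  unfold arrayMeasure; infer_instance

theorem map_arrayEntry (h0 : 0 ≤ a) (h1 : a ≤ 1) (n : ℕ) (k : Fin n) :
    (arrayMeasure a).map (arrayEntry n k) = rowLaw a n := by
  have := isProbabilityMeasure_rowLaw h0 h1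
  exact Measure.infinitePi_map_eval (fun i : Σ n : ℕ, Fin n => rowLaw a i.1) ⟨n, k⟩

theorem iIndepFun_arrayEntry (h0 : 0 ≤ a) (h1 : a ≤ 1) (n : ℕ) :
    iIndepFun (arrayEntry n) (arrayMeasure a) := by
  have := isProbabilityMeasure_rowLaw h0 h1
  have h : iIndepFun (fun (i : Σ n : ℕ, Fin n) (ω : (Σ n : ℕ, Fin n) → ℝ) => ω i)
      (arrayMeasure a) :=
    iIndepFun_infinitePi (P := fun i : Σ n : ℕ, Fin n => rowLaw a i.1)
      (X := fun _ x => x) fun _ => measurable_id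
  exact h.precomp (g := Sigma.mk n) sigma_mk_injective

theorem integral_comp_arrayEntry (h0 : 0 ≤ a) (h1 : a ≤ 1) (n : ℕ) (k : Fin n) {f : ℝ → ℝ}
    (hf : Measurable f) :
    ∫ ω, f (arrayEntry n k ω) ∂(arrayMeasure a) = ∫ x, f x ∂(rowLaw a n) := by
  rw [← map_arrayEntry h0 h1 n k,
    integral_map (measurable_arrayEntry n k).aemeasurable hf.aestronglyMeasurable]

theorem charFun_map_sum_arrayEntry (h0 : 0 ≤ a) (h1 : a ≤ 1) (n : ℕ) (t : ℝ) :
    charFun ((arrayMeasure a).map fun ω => ∑ k : Fin n, arrayEntry n k ω) t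
      = ((rowCharFun a n t ^ n : ℝ) : ℂ) := by
  rw [(iIndepFun_arrayEntry h0 h1 n).charFun_map_fun_sum_eq_prod
    fun k => (measurable_arrayEntry n k).aemeasurable]
  simp [map_arrayEntry h0 h1, charFun_rowLaw h0 h1]

theorem isSTA_arrayEntry (h0 : 0 ≤ a) (h1 : a < 1) : IsSTA (arrayMeasure a) arrayEntry where
  measurable := measurable_arrayEntry
  square_integrable n k := by
    refine (memLp_two_iff_integrable_sq (measurable_arrayEntry n k).aestronglyMeasurable).2 ?_
    have := integrable_rowLaw a n fun x => x ^ 2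
    rw [← map_arrayEntry h0 h1.le n k] at this
    exact this.comp_measurable (measurable_arrayEntry n k)
  indep := iIndepFun_arrayEntry h0 h1.le
  mean_zero n k := by
    rw [integral_comp_arrayEntry h0 h1.le n k measurable_id', integral_id_rowLaw h0 h1.le]
  sum_variance n hn := by
    have hn0 : (n : ℝ) ≠ 0 := by positivity
    simp_rw [integral_comp_arrayEntry h0 h1.le n _ (f := fun x => x ^ 2) (by fun_prop),
      integral_sq_rowLaw h0 h1 hn]
    simp [hn0]

theorem fellerNegligible_arrayEntry (h0 : 0 ≤ a) (h1 : a < 1) :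
    FellerNegligible (arrayMeasure a) arrayEntry := by
  refine tendsto_one_div_atTop_nhds_zero_nat.congr' ?_
  filter_upwards [eventually_ge_atTop 1] with n hn
  have : Nonempty (Fin n) := ⟨⟨0, hn⟩⟩
  simp_rw [integral_comp_arrayEntry h0 h1.le n _ (f := fun x => x ^ 2) (by fun_prop),
    integral_sq_rowLaw h0 h1 hn]
  rw [ciSup_const]

/-- Once `smallJump a n < ε` only the unit jumps can pass the truncation, so the sums are eventually
constant. -/
theorem limsup_lindeberg_arrayEntry (h0 : 0 ≤ a) (h1 : a < 1) {ε : ℝ} (hε : 0 < ε) :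
    limsup (fun n : ℕ => ∑ k : Fin n,
      ∫ ω in {ω | ε ≤ |arrayEntry n k ω|}, (arrayEntry n k ω) ^ 2 ∂(arrayMeasure a)) atTop
      = if ε ≤ 1 then a else 0 := by
  refine Tendsto.limsup_eq (tendsto_const_nhds.congr' ?_)
  filter_upwards [eventually_ge_atTop 1, (tendsto_smallJump a).eventually_lt_const hε] with n hn hb
  have hS : MeasurableSet {x : ℝ | ε ≤ |x|} := measurableSet_le measurable_const measurable_abs
  have h (k : Fin n) :
      ∫ ω in {ω | ε ≤ |arrayEntry n k ω|}, (arrayEntry n k ω) ^ 2 ∂(arrayMeasure a)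
        = ∫ x, {x : ℝ | ε ≤ |x|}.indicator (fun x => x ^ 2) x ∂(rowLaw a n) := by
    rw [← integral_comp_arrayEntry h0 h1.le n k ((measurable_id'.pow_const 2).indicator hS),
      ← integral_indicator (show MeasurableSet {ω | ε ≤ |arrayEntry n k ω|} from
        measurable_arrayEntry n k hS)]
    rfl
  simp_rw [h]
  have := integral_indicator_sq_rowLaw h0 h1 hn ε
  rw [if_neg hb.not_ge, add_zero] at this
  simpa using this.symm

theorem lindebergIndex_arrayEntry (h0 : 0 ≤ a) (h1 : a < 1) :
    lindebergIndex (arrayMeasure a) arrayEntry = a := by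
  have h : lindebergIndex (arrayMeasure a) arrayEntry
      = ⨆ ε : Set.Ioi (0 : ℝ), if (ε : ℝ) ≤ 1 then a else 0 :=
    iSup_congr fun ε => limsup_lindeberg_arrayEntry h0 h1 ε.2
  have hle (ε : Set.Ioi (0 : ℝ)) : (if (ε : ℝ) ≤ 1 then a else 0) ≤ a := by
    split_ifs <;> simp [h0]
  rw [h]
  have : Nonempty (Set.Ioi (0 : ℝ)) := ⟨⟨1, Set.mem_Ioi.2 one_pos⟩⟩
  refine le_antisymm (ciSup_le hle) ?_
  -- The supremum is attained at `ε = 1`, since the truncation `1 ≤ |x|` keeps the unit jumps.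
  refine le_trans ?_ (le_ciSup ⟨a, Set.forall_mem_range.2 hle⟩ ⟨1, Set.mem_Ioi.2 one_pos⟩)
  simp

/-! ### The lower bound linear in the Lindeberg index, and the contradiction. -/

theorem mul_integral_cosExcess_le_limsup_kolmogorovDist {Ω' : Type*} [MeasurableSpace Ω']
    {ν : Measure Ω'} [IsProbabilityMeasure ν] {ξ : Ω' → ℝ}
    (hξ : HasLaw ξ (gaussianReal 0 1) ν) (h0 : 0 ≤ a) (h1 : a < 1) :
    a * (∫ t, cosExcess t ∂(gaussianReal 0 1)) / 2 ≤
      limsup (fun n : ℕ => kolmogorovDist ν (arrayMeasure a) ξ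
        (fun ω => ∑ k : Fin n, arrayEntry n k ω)) atTop := by
  have := isProbabilityMeasure_arrayMeasure h0 h1.le
  set G := gaussianReal 0 1
  have hmeas (n : ℕ) : Measurable fun ω => ∑ k : Fin n, arrayEntry n k ω :=
    Finset.measurable_fun_sum _ fun k _ => measurable_arrayEntry n k
  have hsum (n : ℕ) : ∫ x, Real.exp (-x ^ 2 / 2)
      ∂((arrayMeasure a).map fun ω => ∑ k : Fin n, arrayEntry n k ω)
        = ∫ t, rowCharFun a n t ^ n ∂G := by
    have := Measure.isProbabilityMeasure_map (μ := arrayMeasure a) (hmeas n).aemeasurable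
    rw [← Complex.ofReal_inj, ofReal_integral_exp_neg_sq_div_two, ← integral_complex_ofReal]
    simp_rw [charFun_map_sum_arrayEntry h0 h1.le]
    rfl
  have hG : ∫ x, Real.exp (-x ^ 2 / 2) ∂(ν.map ξ) = ∫ t, Real.exp (-t ^ 2 / 2) ∂G := by
    rw [hξ.map_eq]
  have hlim : Tendsto (fun n : ℕ => (∫ t, rowCharFun a n t ^ n ∂G
      - ∫ t, Real.exp (-t ^ 2 / 2) ∂G) / 2) atTop
      (𝓝 ((∫ t, Real.exp (limitExponent a t) ∂G - ∫ t, Real.exp (-t ^ 2 / 2) ∂G) / 2)) :=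
    ((tendsto_integral_rowCharFun_pow h0 h1 G).sub_const _).div_const 2
  have hge : a * (∫ t, cosExcess t ∂G) ≤
      ∫ t, Real.exp (limitExponent a t) ∂G - ∫ t, Real.exp (-t ^ 2 / 2) ∂G := by
    rw [le_sub_iff_add_le', ← integral_const_mul,
      ← integral_add (integrable_exp_neg_sq_div_two G) ((integrable_cosExcess G).const_mul a)]
    exact integral_mono
      ((integrable_exp_neg_sq_div_two G).add ((integrable_cosExcess G).const_mul a))
      (integrable_exp_limitExponent h0 h1.le G) (add_mul_cosExcess_le a)
  calc _ ≤ (∫ t, Real.exp (limitExponent a t) ∂G - ∫ t, Real.exp (-t ^ 2 / 2) ∂G) / 2 := by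
        linarith
    _ = _ := hlim.limsup_eq.symm
    _ ≤ _ := by
      refine limsup_le_limsup (Eventually.of_forall fun n => ?_)
        hlim.isBoundedUnder_ge.isCoboundedUnder_le
        (isBoundedUnder_of ⟨1, fun n => kolmogorovDist_le_one _ _ _ _⟩)
      have h := abs_integral_exp_neg_sq_div_two_sub_le_kolmogorovDist (μ := ν) hξ.aemeasurable
        (hmeas n).aemeasurable (ν := arrayMeasure a)
      rw [hsum, hG, abs_sub_comm] at h
      have := (le_abs_self _).trans h
      dsimp only
      linarith

end Array

end LindebergFeller

theorem theorem4p3 {Ω' : Type*} [MeasurableSpace Ω'] (ν : Measure Ω') [IsProbabilityMeasure ν]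
    (ξ : Ω' → ℝ) (hξ : HasLaw ξ (gaussianReal 0 1) ν) :
    ¬ ∃ C p : ℝ, 0 < C ∧ 0 < p ∧
      ∀ (Ω : Type) [MeasurableSpace Ω] (μ : Measure Ω) [IsProbabilityMeasure μ]
        (X : (n : ℕ) → Fin n → Ω → ℝ),
        LindebergFeller.IsSTA μ X → LindebergFeller.FellerNegligible μ X →
          limsup (fun n : ℕ =>
              LindebergFeller.kolmogorovDist ν μ ξ (fun ω => ∑ k : Fin n, X n k ω)) atTop
            ≤ C * (LindebergFeller.lindebergIndex μ X) ^ (1 + p) := by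
  rintro ⟨C, p, -, hp, hbound⟩
  have hc := LindebergFeller.integral_cosExcess_pos
  set c := ∫ t, LindebergFeller.cosExcess t ∂(gaussianReal 0 1)
  -- One factor `a` cancels between the linear lower bound and `a ^ (1 + p)`; the remaining
  -- right-hand side vanishes as `a → 0` because `p > 0`.
  have key (a : ℝ) (ha0 : 0 < a) (ha1 : a < 1) : c / 2 ≤ C * a ^ p := by
    have := LindebergFeller.isProbabilityMeasure_arrayMeasure ha0.le ha1.le
    have h := (LindebergFeller.mul_integral_cosExcess_le_limsup_kolmogorovDist hξ ha0.le ha1).trans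
      (hbound _ (LindebergFeller.arrayMeasure a) LindebergFeller.arrayEntry
        (LindebergFeller.isSTA_arrayEntry ha0.le ha1)
        (LindebergFeller.fellerNegligible_arrayEntry ha0.le ha1))
    rw [LindebergFeller.lindebergIndex_arrayEntry ha0.le ha1, Real.rpow_add ha0,
      Real.rpow_one] at h
    refine le_of_mul_le_mul_left ?_ ha0
    linarith
  have hlim : Tendsto (fun a : ℝ => C * a ^ p) (𝓝[>] 0) (𝓝 0) := by
    have : Tendsto (fun a : ℝ => C * a ^ p) (𝓝 0) (𝓝 (C * 0 ^ p)) :=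
      (Real.continuousAt_rpow_const 0 p (Or.inr hp.le)).tendsto.const_mul C
    rw [Real.zero_rpow hp.ne', mul_zero] at this
    exact this.mono_left nhdsWithin_le_nhds
  have hle : c / 2 ≤ 0 := by
    refine ge_of_tendsto hlim ?_
    filter_upwards [Ioo_mem_nhdsGT (zero_lt_one (α := ℝ))] with a ha
    exact key a ha.1 ha.2
  linarith
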